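/- Let $F$ be a field, let $\sigma : F \to F$ be a ring endomorphism of finite order $m \ge 1$ (that is, $\sigma^m = \mathrm{Id}$ with $m$ minimal), and let $K = \{\beta \in F \mid \sigma(\beta) = \beta\}$ be its fixed field. Let $\mathrm{T}_{F/K} : F \to K$, $\mathrm{T}_{F/K}(a) = \sum_{i=0}^{m-1} \sigma^i(a)$, be the trace. Let $F[x;\sigma,0]$ be the skew polynomial ring over $F$ with left $F$-basis $1, x, x^2, \ldots$ and multiplication determined by $xa = \sigma(a)x$ for $a \in F$. An element $b \in F$ is called a zero of $P \in F[x;\sigma,0]$ if $x-b$ divides $P$ on the right, i.e. $P = Q(x-b)$ for some $Q \in F[x;\sigma,0]$. For $r \ge 1$, a sequence $(a_1,\ldots,a_r) \in F^r$ is called a $(\sigma,0)$-multiplicity sequence if $a_1$ is the only zero in $F$ of $$P_{\mathbf a} = (x-a_r)\cdots(x-a_2)(x-a_1).$$ Then, for every $r \ge 1$, a sequence $(a_1,\ldots,a_r) \in F^r$ is a $(\sigma,0)$-multiplicity sequence if and only if either $a_1 = a_2 = \cdots = a_r = 0$, or $a_1 \neq 0$ and for each $i = 1, \ldots, r-1$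 there exists $\beta_i \in F^*$ such that $$a_{i+1} = \sigma(\beta_i)\beta_i^{-1}a_i \quad\text{and}\quad \mathrm{T}_{F/K}\left(\beta_i a_i^{-1}\right) \neq 0.$$ In particular, for $a \in F^*$ and $r \ge 2$, the constant sequence $(a,\ldots,a) \in F^r$ is a $(\sigma,0)$-multiplicity sequence if and only if $\mathrm{T}_{F/K}(a^{-1}) \neq 0$. -/

import Mathlib

noncomputable section

namespace SkewMult

variable {F : Type*} [Field F]

/-- The action of `Multiplicative ℕ` on `F` in which `n` acts as the `n`-th iterate of `σ`.
With it, Mathlib's `SkewPolynomial F` is the ring `F[x; σ, 0]`, in which `x * c = σ c * x`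
(see `X_mul_C` below). -/
abbrev twist (σ : F →+* F) : MulSemiringAction (Multiplicative ℕ) F :=
  MulSemiringAction.compHom F (powersHom (F →+* F) σ)

/-- The defining commutation rule `x c = σ(c) x` of `F[x; σ, 0]`. -/
theorem X_mul_C (σ : F →+* F) (c : F) :
    letI := twist σ
    (SkewPolynomial.X : SkewPolynomial F) * SkewPolynomial.C c
      = SkewPolynomial.C (σ c) * SkewPolynomial.X := by
  let _ := twist σ
  have h : (SkewPolynomial.φ : F →+* F) c = σ c := by
    change ((powersHom (F →+* F) σ) (Multiplicative.ofAdd 1)) c = σ c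
    simp
  rw [← SkewPolynomial.monomial_zero_left, SkewPolynomial.X_mul_monomial,
    ← SkewPolynomial.monomial_zero_left, SkewPolynomial.monomial_mul_X, h]

/-- The skew polynomial `P_a = (x - a_r) ⋯ (x - a_2) (x - a_1)` in `F[x; σ, 0]` of a sequence
`a = (a_1, …, a_r)`; the entry `a_{i+1}` is `a i` for `i : Fin r`. -/
def seqPoly (σ : F →+* F) {r : ℕ} (a : Fin r → F) : SkewPolynomial F :=
  letI := twist σ
  (List.ofFn fun i => SkewPolynomial.X - SkewPolynomial.C (a i)).reverse.prod

/-- `b` is a (right) zero of `P ∈ F[x; σ, 0]`: the remainder in the right division of `P` by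
`x - b` is zero, that is, `P = Q * (x - b)` for some `Q`. -/
def IsZero (σ : F →+* F) (P : SkewPolynomial F) (b : F) : Prop :=
  letI := twist σ
  ∃ Q : SkewPolynomial F, P = Q * (SkewPolynomial.X - SkewPolynomial.C b)

/-- A sequence of positive length `r + 1` is a `(σ, 0)`-multiplicity sequence if its first entry
is the only zero of its skew polynomial `P_a`. -/
def IsMultiplicitySeq (σ : F →+* F) {r : ℕ} (a : Fin (r + 1) → F) : Prop :=
  {b : F | IsZero σ (seqPoly σ a) b} = {a 0}

/-- The subfield `K = {β ∈ F | σ β = β}`. -/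
def fixedField (σ : F →+* F) : Subfield F := σ.eqLocusField (RingHom.id F)

theorem sum_iterate_mem_fixedField (σ : F →+* F) (a : F) :
    ∑ i ∈ Finset.range (orderOf σ), σ^[i] a ∈ fixedField σ := by
  change σ (∑ i ∈ Finset.range (orderOf σ), σ^[i] a) = ∑ i ∈ Finset.range (orderOf σ), σ^[i] a
  have h : σ^[orderOf σ] a = a := by
    rw [← RingHom.coe_pow, pow_orderOf_eq_one]; rfl
  have h1 := Finset.sum_range_succ (fun i => σ^[i] a) (orderOf σ)
  rw [Finset.sum_range_succ'] at h1
  simp only [h, Function.iterate_zero, id] at h1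
  rw [map_sum]
  simpa [← Function.iterate_succ_apply'] using add_right_cancel h1

/-- The trace `T_{F/K} : F → K`, `T(a) = ∑_{i=0}^{m-1} σ^i(a)`, where `m` is the (finite) order
of `σ`. -/
def trace (σ : F →+* F) (a : F) : fixedField σ :=
  ⟨∑ i ∈ Finset.range (orderOf σ), σ^[i] a, sum_iterate_mem_fixedField σ a⟩

end SkewMult

end

/-! Write `T_p u = b σ(u) - p u`. The remainder of `P_a` on right division by `x - b` is the
composite of the `T_{a_i}` applied to `1`. The first entry is always a zero, and being its only zero
reduces to a condition on adjacent entries (`IsLinked`). If all pairs are linked, `T_q ∘ T_p` has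
the kernel of `T_p` for every `b`, so a zero of `P_a` is already a zero of `x - a_1`. Conversely, if
a last pair `(p, q)` is not linked and `q ≠ 0`, work at `b = q`. There `1` lies in the range of
`T_p`, hence of the whole shorter product, whose range is that of its last factor. A preimage `u` of
`1` gives the further zero `q σ(u) / u`. Additive Hilbert 90 decides which elements are in the range
of `T_p`. -/

namespace SkewMult

section Evaluation

variable {F : Type*} [Field F]

/-- The value at `b` of a skew polynomial, that is, its remainder on right division by `x - b`. -/
noncomputable def evalAt (σ : F →+* F) (b : F) (P : SkewPolynomial F) : F :=
  SkewMonoidAlgebra.sum P fun n c => c * ∏ i ∈ Finset.range n.toAdd, σ^[i] b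

theorem evalAt_add (σ : F →+* F) (b : F) (P Q : SkewPolynomial F) :
    evalAt σ b (P + Q) = evalAt σ b P + evalAt σ b Q :=
  SkewMonoidAlgebra.sum_add_index' (by simp) (by simp [add_mul])

theorem evalAt_monomial (σ : F →+* F) (b : F) (n : ℕ) (c : F) :
    evalAt σ b (SkewPolynomial.monomial n c) = c * ∏ i ∈ Finset.range n, σ^[i] b :=
  SkewMonoidAlgebra.sum_single_index (by simp)

theorem evalAt_sub (σ : F →+* F) (b : F) (P Q : SkewPolynomial F) :
    evalAt σ b (P - Q) = evalAt σ b P - evalAt σ b Q := by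
  rw [eq_sub_iff_add_eq, ← evalAt_add, sub_add_cancel]

theorem evalAt_mul_X_sub_C (σ : F →+* F) (b : F) (Q : SkewPolynomial F) :
    letI := twist σ
    evalAt σ b (Q * (SkewPolynomial.X - SkewPolynomial.C b)) = 0 := by
  let _ := twist σ
  have hφ : (SkewPolynomial.φ : F →+* F) = σ := by
    ext c
    change ((powersHom (F →+* F) σ) (Multiplicative.ofAdd 1)) c = σ c
    simp
  induction Q using SkewMonoidAlgebra.induction_on with
  | zero =>
    rw [zero_mul]
    exact SkewMonoidAlgebra.sum_zero_index
  | add f g hf hg => rw [add_mul, evalAt_add, hf, hg, add_zero]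
  | single n c =>
    change evalAt σ b (SkewPolynomial.monomial n.toAdd c * _) = 0
    rw [mul_sub, evalAt_sub, SkewPolynomial.monomial_mul_X, SkewPolynomial.monomial_mul_C,
      evalAt_monomial, evalAt_monomial, Finset.prod_range_succ, hφ]
    ring

end Evaluation

/-! ### Remainders as composites of twisted operators -/

section Operators

variable {F : Type*} [Field F]

/-- The operator `u ↦ b σ(u) - p u`, linear over the fixed field of `σ`. -/
def twistedSub (σ : F →+* F) (b p : F) : F →ₗ[fixedField σ] F where
  toFun u := b * σ u - p * u
  map_add' u v := by rw [map_add]; ring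
  map_smul' c u := by
    have hc : σ c = c := c.2
    simp only [Subfield.smul_def, smul_eq_mul, map_mul, hc, RingHom.id_apply]
    ring

theorem twistedSub_apply (σ : F →+* F) (b p u : F) :
    twistedSub σ b p u = b * σ u - p * u := rfl

/-- The composition of the operators `twistedSub σ b (a i)` for `i < k`, the one for `i = 0` being
applied first. -/
def twistedProd (σ : F →+* F) (b : F) (a : ℕ → F) : ℕ → F → F
  | 0, u => u
  | k + 1, u => twistedSub σ b (a k) (twistedProd σ b a k u)

theorem twistedProd_succ (σ : F →+* F) (b : F) (a : ℕ → F) (k : ℕ) (u : F) :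
    twistedProd σ b a (k + 1) u = twistedSub σ b (a k) (twistedProd σ b a k u) := rfl

theorem twistedProd_one (σ : F →+* F) (b : F) (a : ℕ → F) (u : F) :
    twistedProd σ b a 1 u = twistedSub σ b (a 0) u := rfl

/-- Passing from `e` to its σ-conjugate `b = e σ(u) / u` amounts to substituting `v * u` for `v`, so
vectors killed at `e` yield zeros conjugate to `e`. -/
theorem twistedProd_mul (σ : F →+* F) {b e u : F} (h : b * u = e * σ u) (a : ℕ → F) (k : ℕ)
    (v : F) : twistedProd σ e a k (v * u) = twistedProd σ b a k v * u := by
  induction k with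
  | zero => rfl
  | succ k ih =>
    simp only [twistedProd_succ, ih, twistedSub_apply, map_mul]
    linear_combination (-σ (twistedProd σ b a k v)) * h

theorem seqPoly_succ (σ : F →+* F) (a : ℕ → F) (k : ℕ) :
    letI := twist σ
    seqPoly σ (fun i : Fin (k + 1) => a i)
      = (SkewPolynomial.X - SkewPolynomial.C (a k)) * seqPoly σ (fun i : Fin k => a i) := by
  rw [seqPoly, List.ofFn_succ']
  simp [seqPoly]

theorem exists_seqPoly_eq (σ : F →+* F) (b : F) (a : ℕ → F) (k : ℕ) :
    letI := twist σ
    ∃ Q : SkewPolynomial F, seqPoly σ (fun i : Fin k => a i)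
      = Q * (SkewPolynomial.X - SkewPolynomial.C b)
        + SkewPolynomial.C (twistedProd σ b a k 1) := by
  let _ := twist σ
  induction k with
  | zero => exact ⟨0, by simp [seqPoly, twistedProd, SkewPolynomial.C_1]⟩
  | succ k ih =>
    obtain ⟨Q, hQ⟩ := ih
    set c := twistedProd σ b a k 1 with hc
    refine ⟨(SkewPolynomial.X - SkewPolynomial.C (a k)) * Q + SkewPolynomial.C (σ c), ?_⟩
    have h : twistedProd σ b a (k + 1) 1 = σ c * b - a k * c := by
      rw [twistedProd_succ, twistedSub_apply, ← hc, mul_comm b]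
    rw [seqPoly_succ, hQ, h, map_sub, SkewPolynomial.C_mul, SkewPolynomial.C_mul, mul_add,
      sub_mul _ _ (SkewPolynomial.C c), X_mul_C, add_mul, mul_assoc, mul_sub (SkewPolynomial.C _)]
    abel

theorem isZero_seqPoly_iff (σ : F →+* F) (b : F) (a : ℕ → F) (k : ℕ) :
    IsZero σ (seqPoly σ (fun i : Fin k => a i)) b ↔ twistedProd σ b a k 1 = 0 := by
  let _ := twist σ
  obtain ⟨Q, hQ⟩ := exists_seqPoly_eq σ b a k
  constructor
  · rintro ⟨P, hP⟩
    -- Evaluation kills left multiples of `x - b`, so the constant remainder is unique.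
    have h := congrArg (evalAt σ b) (hQ.symm.trans hP)
    rw [evalAt_add, evalAt_mul_X_sub_C, evalAt_mul_X_sub_C, ← SkewPolynomial.monomial_zero_left,
      evalAt_monomial] at h
    simpa using h
  · intro h
    exact ⟨Q, by rw [hQ, h, map_zero, add_zero]⟩

theorem twistedProd_self (σ : F →+* F) (a : ℕ → F) (k : ℕ) :
    twistedProd σ (a 0) a (k + 1) 1 = 0 := by
  induction k with
  | zero => simp [twistedProd_one, twistedSub_apply]
  | succ k ih => rw [twistedProd_succ, ih, map_zero]

theorem isMultiplicitySeq_iff (σ : F →+* F) (a : ℕ → F) (r : ℕ) :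
    IsMultiplicitySeq σ (fun i : Fin (r + 1) => a i) ↔
      ∀ b, twistedProd σ b a (r + 1) 1 = 0 → b = a 0 := by
  simp only [IsMultiplicitySeq, isZero_seqPoly_iff]
  constructor
  · intro h b hb
    exact h.subset hb
  · intro h
    refine Set.Subset.antisymm h ?_
    rintro _ rfl
    exact twistedProd_self σ a r

end Operators

/-! ### Trace and additive Hilbert 90 -/

section Trace

variable {F : Type*} [Field F]

theorem coe_trace (σ : F →+* F) (a : F) :
    (trace σ a : F) = ∑ i ∈ Finset.range (orderOf σ), σ^[i] a := rfl

theorem apply_fixedField (σ : F →+* F) (c : fixedField σ) : σ c = c := c.2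

/-- The trace as a linear map over the fixed field. -/
noncomputable def traceLinear (σ : F →+* F) : F →ₗ[fixedField σ] fixedField σ where
  toFun := trace σ
  map_add' a b := by
    apply Subtype.ext
    simp only [Subfield.coe_add, coe_trace, ← RingHom.coe_pow, map_add, Finset.sum_add_distrib]
  map_smul' c a := by
    apply Subtype.ext
    have hc (i : ℕ) : (σ ^ i) (c : F) = c := by
      rw [RingHom.coe_pow]
      exact Function.iterate_fixed (apply_fixedField σ c) i
    simp only [Subfield.smul_def, smul_eq_mul, Subfield.coe_mul, coe_trace, ← RingHom.coe_pow,
      map_mul, Finset.mul_sum, RingHom.id_apply, hc]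

theorem traceLinear_apply (σ : F →+* F) (a : F) : traceLinear σ a = trace σ a := rfl

theorem trace_apply_sub_self (σ : F →+* F) (a : F) : trace σ (σ a - a) = 0 := by
  apply Subtype.ext
  have h : σ^[orderOf σ] a = a := by
    rw [← RingHom.coe_pow, pow_orderOf_eq_one]; rfl
  have h1 := Finset.sum_range_sub (fun i => σ^[i] a) (orderOf σ)
  rw [coe_trace, Subfield.coe_zero, ← sub_self a]
  conv_rhs => rw [← h]
  simpa [← RingHom.coe_pow, map_sub, pow_succ] using h1

/-- Dedekind's independence of characters, for the distinct powers of `σ`. -/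
theorem traceLinear_ne_zero {σ : F →+* F} (h : 0 < orderOf σ) : traceLinear σ ≠ 0 := by
  intro h0
  have hinj : Function.Injective
      (fun i : Fin (orderOf σ) => ((σ ^ (i : ℕ) : F →+* F) : F →* F)) := by
    intro i j hij
    have : σ ^ (i : ℕ) = σ ^ (j : ℕ) := RingHom.ext fun x => DFunLike.congr_fun hij x
    exact Fin.ext (pow_injOn_Iio_orderOf i.2 j.2 this)
  have hli := (linearIndependent_monoidHom F F).comp _ hinj
  rw [Fintype.linearIndependent_iff] at hli
  refine one_ne_zero (hli (fun _ => (1 : F)) ?_ ⟨0, h⟩)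
  funext a
  have ha : (trace σ a : F) = 0 := by
    rw [← traceLinear_apply, h0]; rfl
  rw [coe_trace, Finset.sum_range] at ha
  simpa [← RingHom.coe_pow] using ha

/-- Artin's theorem for the finite cyclic group generated by `σ`, which is a unit because its order
is finite. -/
theorem finiteDimensional_fixedField {σ : F →+* F} (h : 0 < orderOf σ) :
    FiniteDimensional (fixedField σ) F := by
  have hfin : IsOfFinOrder σ := orderOf_pos_iff.1 h
  let u : (F →+* F)ˣ := hfin.unit
  have hu : IsOfFinOrder u := by
    rw [← orderOf_pos_iff, ← orderOf_units]
    exact h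
  have hG : Finite (Subgroup.zpowers u) := hu.finite_zpowers
  let _ : MulSemiringAction (Subgroup.zpowers u) F :=
    MulSemiringAction.compHom F ((Units.coeHom (F →+* F)).comp (Subgroup.zpowers u).subtype)
  have hK : FixedPoints.subfield (Subgroup.zpowers u) F = fixedField σ := by
    ext x
    constructor
    · intro hx
      exact hx ⟨u, Subgroup.mem_zpowers u⟩
    · intro hx g
      have hmem : u ∈ MulAction.stabilizer (F →+* F)ˣ x := hx
      exact (Subgroup.zpowers_le.2 hmem) g.2
  rw [← hK]
  infer_instance

/-- Additive Hilbert 90. -/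
theorem exists_apply_sub_self_eq {σ : F →+* F} (h : 0 < orderOf σ) {a : F}
    (ha : trace σ a = 0) : ∃ y, σ y - y = a := by
  have := finiteDimensional_fixedField h
  -- Dimension count: the kernel of `σ - 1` is at most a line, so its range has codimension at most
  -- one, and it sits in the proper subspace of trace zero.
  have hle : LinearMap.range (twistedSub σ 1 1) ≤ LinearMap.ker (traceLinear σ) := by
    rintro _ ⟨y, rfl⟩
    rw [LinearMap.mem_ker, traceLinear_apply, twistedSub_apply, one_mul, one_mul]
    exact trace_apply_sub_self σ y
  have hker : Module.finrank (fixedField σ) (LinearMap.ker (twistedSub σ 1 1)) ≤ 1 := by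
    refine finrank_le_one ⟨1, by simp [twistedSub_apply]⟩ ?_
    rintro ⟨w, hw⟩
    have hw' : σ w = w := by
      rw [LinearMap.mem_ker, twistedSub_apply, one_mul, one_mul, sub_eq_zero] at hw
      exact hw
    exact ⟨⟨w, hw'⟩, Subtype.ext (mul_one w)⟩
  have hlt : Module.finrank (fixedField σ) (LinearMap.ker (traceLinear σ))
      < Module.finrank (fixedField σ) F := by
    apply Submodule.finrank_lt
    rw [Ne, LinearMap.ker_eq_top]
    exact traceLinear_ne_zero h
  have hrank := LinearMap.finrank_range_add_finrank_ker (twistedSub σ 1 1)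
  have heq := Submodule.eq_of_le_of_finrank_le hle (by omega)
  have hmem : a ∈ LinearMap.range (twistedSub σ 1 1) := heq ▸ LinearMap.mem_ker.2 ha
  obtain ⟨y, hy⟩ := hmem
  exact ⟨y, by rw [← hy, twistedSub_apply, one_mul, one_mul]⟩

theorem twistedSub_surjective_or_exists {σ : F →+* F} (h : 0 < orderOf σ) (e p : F) :
    Function.Surjective (twistedSub σ e p) ∨ ∃ z, z ≠ 0 ∧ e * σ z = p * z := by
  have := finiteDimensional_fixedField h
  rw [← LinearMap.injective_iff_surjective, injective_iff_map_eq_zero, or_iff_not_imp_left]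
  intro hn
  push Not at hn
  obtain ⟨z, hz, hz0⟩ := hn
  exact ⟨z, hz0, sub_eq_zero.1 hz⟩

end Trace

/-! ### Linked neighbours and the criterion -/

section Adjacent

variable {F : Type*} [Field F]

/-- The condition under which `(x - q) (x - p)` has the single zero `p`. -/
def IsLinked (σ : F →+* F) (p q : F) : Prop :=
  (p = 0 ∧ q = 0) ∨
    (p ≠ 0 ∧ ∃ β : F, β ≠ 0 ∧ q = σ β * β⁻¹ * p ∧ trace σ (β * p⁻¹) ≠ 0)

theorem IsLinked.eq_zero_iff {σ : F →+* F} {p q : F} (h : IsLinked σ p q) : p = 0 ↔ q = 0 := by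
  rcases h with ⟨hp, hq⟩ | ⟨hp, β, hβ, rfl, -⟩
  · simp [hp, hq]
  · simp [hp, hβ]

theorem IsLinked.twistedSub_ne_zero {σ : F →+* F} {p q : F} (h : IsLinked σ p q) {b d : F}
    (hd : twistedSub σ b p d ≠ 0) : twistedSub σ b q (twistedSub σ b p d) ≠ 0 := by
  rcases h with ⟨rfl, rfl⟩ | ⟨hp, β, hβ, rfl, hT⟩
  · simp only [twistedSub_apply, zero_mul, sub_zero] at hd ⊢
    exact mul_ne_zero (left_ne_zero_of_mul hd) ((map_ne_zero σ).2 hd)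
  · intro h0
    set v := twistedSub σ b p d with hv
    have hv' : v = b * σ d - p * d := hv
    have hσv : σ v ≠ 0 := (map_ne_zero σ).2 hd
    have hσβ : σ β ≠ 0 := (map_ne_zero σ).2 hβ
    apply hT
    -- If `v` were killed, then `β / p = σ(w) - w` with `w = β d / v`.
    rw [← trace_apply_sub_self σ (β * d / v)]
    congr 1
    rw [twistedSub_apply] at h0
    have h1 : σ β * p * v = b * σ v * β := by
      field_simp at h0
      linear_combination -h0
    have h2 : σ β * σ d / σ v = β * (v + p * d) / (p * v) := by
      rw [div_eq_div_iff hσv (mul_ne_zero hp hd)]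
      linear_combination σ d * h1 - β * σ v * hv'
    rw [map_div₀, map_mul, h2]
    field_simp
    ring

/-- If `T_p` kills `z ≠ 0` and `p ≠ 0`, its range is `p z` times the trace-zero elements. The vector
`z β` is killed by `T_q` and lies outside that range, so `v` can be corrected by a multiple of it.
-/
theorem IsLinked.exists_twistedSub_eq {σ : F →+* F} (h : 0 < orderOf σ) {p q : F}
    (hpq : IsLinked σ p q) (e v : F) :
    ∃ w, twistedSub σ e q v = twistedSub σ e q (twistedSub σ e p w) := by
  rcases twistedSub_surjective_or_exists h e p with hs | ⟨z, hz, hzp⟩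
  · obtain ⟨w, hw⟩ := hs v
    exact ⟨w, by rw [hw]⟩
  rcases hpq with ⟨rfl, rfl⟩ | ⟨hp, β, hβ, rfl, hT⟩
  · have he : e = 0 := by
      simpa [(map_ne_zero σ).2 hz] using hzp
    exact ⟨0, by simp [he, twistedSub_apply]⟩
  -- The scalar that makes `(v - t z β) / (p z)` have trace zero.
  set t : fixedField σ := trace σ (v * (p * z)⁻¹) * (trace σ (β * p⁻¹))⁻¹ with ht
  obtain ⟨y, hy⟩ := exists_apply_sub_self_eq h (a := v * (p * z)⁻¹ - t • (β * p⁻¹)) (by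
    rw [← traceLinear_apply, map_sub, map_smul, traceLinear_apply, traceLinear_apply, ht,
      smul_eq_mul, inv_mul_cancel_right₀ hT, sub_self])
  refine ⟨z * y, ?_⟩
  have h1 : twistedSub σ e p (z * y) = v - t * (z * β) := by
    rw [Subfield.smul_def, smul_eq_mul] at hy
    rw [twistedSub_apply, map_mul]
    have : p * z * (σ y - y) = v - t * (z * β) := by
      rw [hy]
      field_simp
    linear_combination this + σ y * hzp
  rw [h1, map_sub, eq_comm, sub_eq_self, twistedSub_apply, map_mul, map_mul, apply_fixedField]
  field_simp
  linear_combination (σ β * t) * hzp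

theorem exists_twistedProd_eq {σ : F →+* F} (h : 0 < orderOf σ) {a : ℕ → F} {k : ℕ}
    (ha : ∀ i < k, IsLinked σ (a i) (a (i + 1))) (e v : F) :
    ∃ u, twistedProd σ e a (k + 1) u = twistedSub σ e (a k) v := by
  induction k generalizing v with
  | zero => exact ⟨v, rfl⟩
  | succ k ih =>
    obtain ⟨w, hw⟩ := (ha k k.lt_succ_self).exists_twistedSub_eq h e v
    obtain ⟨u, hu⟩ := ih (fun i hi => ha i (hi.trans k.lt_succ_self)) w
    exact ⟨u, by rw [twistedProd_succ, hu, hw]⟩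

theorem exists_twistedSub_eq_one {σ : F →+* F} (h : 0 < orderOf σ) {p q : F} (hq : q ≠ 0)
    (hpq : ¬ IsLinked σ p q) : ∃ v, twistedSub σ q p v = 1 := by
  rcases twistedSub_surjective_or_exists h q p with hs | ⟨z, hz, hzp⟩
  · exact hs 1
  have hσz : σ z ≠ 0 := (map_ne_zero σ).2 hz
  have hp : p ≠ 0 := by
    rintro rfl
    rw [zero_mul] at hzp
    exact mul_ne_zero hq hσz hzp
  have hT : trace σ (z⁻¹ * p⁻¹) = 0 := by
    by_contra hT
    -- `q σ(z) = p z` exhibits `q` as the conjugate of `p` by `β = z⁻¹`, so only the trace condition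
    -- can fail.
    refine hpq (Or.inr ⟨hp, z⁻¹, inv_ne_zero hz, ?_, hT⟩)
    rw [map_inv₀, inv_inv, mul_assoc, mul_comm z, ← hzp]
    field_simp
  obtain ⟨y, hy⟩ := exists_apply_sub_self_eq h hT
  refine ⟨z * y, ?_⟩
  have : p * z * (σ y - y) = 1 := by
    rw [hy]
    field_simp
  rw [twistedSub_apply, map_mul]
  linear_combination this + σ y * hzp

theorem twistedProd_ne_zero_of_isLinked {σ : F →+* F} {a : ℕ → F} {r : ℕ}
    (ha : ∀ i < r, IsLinked σ (a i) (a (i + 1))) {b : F} (hb : b ≠ a 0) :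
    twistedProd σ b a (r + 1) 1 ≠ 0 := by
  induction r with
  | zero => simpa [twistedProd_one, twistedSub_apply, sub_eq_zero] using hb
  | succ r ih =>
    exact (ha r r.lt_succ_self).twistedSub_ne_zero
      (ih fun i hi => ha i (hi.trans r.lt_succ_self))

theorem isLinked_of_forall_twistedProd {σ : F →+* F} (h : 0 < orderOf σ) {a : ℕ → F} {r : ℕ}
    (ha : ∀ b, twistedProd σ b a (r + 1) 1 = 0 → b = a 0) :
    ∀ i < r, IsLinked σ (a i) (a (i + 1)) := by
  induction r with
  | zero => intro i hi; omega
  | succ r ih =>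
    have hr := ih fun b hb => ha b (by rw [twistedProd_succ, hb, map_zero])
    intro i hi
    rcases Nat.lt_succ_iff_lt_or_eq.1 hi with hi | rfl
    · exact hr i hi
    by_contra hn
    by_cases hq : a (i + 1) = 0
    -- When the last entry is `0`, so is the remainder at `b = 0`. Thus `a 0 = 0`, and the links
    -- carry this to the whole sequence.
    · have h0 : a 0 = 0 := (ha 0 (by
        rw [twistedProd_succ, twistedSub_apply, hq]; ring)).symm
      have hall : ∀ j ≤ i, a j = 0 := by
        intro j
        induction j with
        | zero => exact fun _ => h0
        | succ j ihj => exact fun hj => (hr j hj).eq_zero_iff.1 (ihj (by omega))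
      exact hn (Or.inl ⟨hall i le_rfl, hq⟩)
    · obtain ⟨v, hv⟩ := exists_twistedSub_eq_one h hq hn
      obtain ⟨u, hu⟩ := exists_twistedProd_eq h hr (a (i + 1)) v
      rw [hv] at hu
      have hu0 : u ≠ 0 := by
        rintro rfl
        have := twistedProd_mul σ (b := 0) (e := a (i + 1)) (u := 0) (by simp) a (i + 1) 0
        rw [mul_zero, mul_zero, hu] at this
        exact one_ne_zero this
      -- At this `b` the shorter product has value `u⁻¹ ≠ 0`, but the next factor sends `1` to `0`
      -- at `e`. So `b` is a zero of the longer product only, whereas `a 0` is a zero of both.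
      have hm := twistedProd_mul σ (b := a (i + 1) * σ u / u) (e := a (i + 1)) (u := u)
        (div_mul_cancel₀ _ hu0) a
      have h1 := hm (i + 1) 1
      have h2 := hm (i + 2) 1
      rw [one_mul, hu] at h1
      rw [one_mul, twistedProd_succ, hu, twistedSub_apply, map_one, sub_self, eq_comm,
        mul_eq_zero, or_iff_left hu0] at h2
      rw [ha _ h2, twistedProd_self, zero_mul] at h1
      exact one_ne_zero h1

theorem isMultiplicitySeq_iff_isLinked {σ : F →+* F} (h : 0 < orderOf σ) (a : ℕ → F) (r : ℕ) :
    IsMultiplicitySeq σ (fun i : Fin (r + 1) => a i) ↔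
      ∀ i < r, IsLinked σ (a i) (a (i + 1)) := by
  rw [isMultiplicitySeq_iff]
  refine ⟨isLinked_of_forall_twistedProd h, fun ha b hb => ?_⟩
  by_contra hne
  exact twistedProd_ne_zero_of_isLinked ha hne hb

theorem isMultiplicitySeq_iff_forall_fin {σ : F →+* F} (h : 0 < orderOf σ) {r : ℕ}
    (a : Fin (r + 1) → F) :
    IsMultiplicitySeq σ a ↔ ∀ i : Fin r, IsLinked σ (a i.castSucc) (a i.succ) := by
  -- The padding value `0` is never read: only indices up to `r` occur.
  let A : ℕ → F := fun n => if hn : n < r + 1 then a ⟨n, hn⟩ else 0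
  have hA : a = fun i : Fin (r + 1) => A i := by
    funext i
    simp only [A, dif_pos i.2]
  rw [hA, isMultiplicitySeq_iff_isLinked h A r]
  exact ⟨fun H i => H i i.2, fun H i hi => H ⟨i, hi⟩⟩

theorem forall_isLinked_iff (σ : F →+* F) {r : ℕ} (a : Fin (r + 1) → F) :
    (∀ i : Fin r, IsLinked σ (a i.castSucc) (a i.succ)) ↔
      (∀ i, a i = 0) ∨
      (a 0 ≠ 0 ∧ ∀ i : Fin r, ∃ β : F, β ≠ 0 ∧
        a i.succ = σ β * β⁻¹ * a i.castSucc ∧ trace σ (β * (a i.castSucc)⁻¹) ≠ 0) := by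
  constructor
  · intro H
    have hz : ∀ i, a i = 0 ↔ a 0 = 0 := fun i => by
      induction i using Fin.induction with
      | zero => rfl
      | succ i ih => rw [← (H i).eq_zero_iff, ih]
    by_cases h0 : a 0 = 0
    · exact Or.inl fun i => (hz i).2 h0
    · refine Or.inr ⟨h0, fun i => ?_⟩
      rcases H i with ⟨hi, -⟩ | ⟨-, hi⟩
      · exact absurd ((hz _).1 hi) h0
      · exact hi
  · rintro (H | ⟨h0, H⟩) i
    · exact Or.inl ⟨H _, H _⟩
    · have hne : ∀ j, a j ≠ 0 := fun j => by
        induction j using Fin.induction with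
        | zero => exact h0
        | succ j ih =>
          obtain ⟨β, hβ, hj, -⟩ := H j
          rw [hj]
          exact mul_ne_zero (mul_ne_zero ((map_ne_zero σ).2 hβ) (inv_ne_zero hβ)) ih
      exact Or.inr ⟨hne _, H i⟩

theorem isLinked_self_iff (σ : F →+* F) {a : F} (ha : a ≠ 0) :
    IsLinked σ a a ↔ trace σ a⁻¹ ≠ 0 := by
  constructor
  · rintro (⟨h0, -⟩ | ⟨-, β, hβ, h1, hT⟩) h0'
    · exact ha h0
    -- Equal entries force `β` into the fixed field, so it factors out of the trace.
    · have hβ' : σ β = β := by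
        field_simp at h1
        exact h1.symm
      apply hT
      have := (traceLinear σ).map_smul (⟨β, hβ'⟩ : fixedField σ) a⁻¹
      rw [traceLinear_apply, traceLinear_apply, h0', smul_zero] at this
      exact this
  · intro hT
    exact Or.inr ⟨ha, 1, one_ne_zero, by simp, by simpa using hT⟩

end Adjacent

end SkewMult

theorem mainTheorem11 {F : Type*} [Field F] (σ : F →+* F) (m : ℕ) (hm : 0 < m)
    (hσ : orderOf σ = m) :
    (∀ (r : ℕ) (a : Fin (r + 1) → F),
      SkewMult.IsMultiplicitySeq σ a ↔
        (∀ i, a i = 0) ∨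
        (a 0 ≠ 0 ∧ ∀ i : Fin r, ∃ β : F, β ≠ 0 ∧
          a i.succ = σ β * β⁻¹ * a i.castSucc ∧
          SkewMult.trace σ (β * (a i.castSucc)⁻¹) ≠ 0)) ∧
    (∀ (r : ℕ) (a : F), 2 ≤ r + 1 → a ≠ 0 →
      (SkewMult.IsMultiplicitySeq σ (fun _ : Fin (r + 1) => a) ↔
        SkewMult.trace σ a⁻¹ ≠ 0)) := by
  have h : 0 < orderOf σ := hσ ▸ hm
  refine ⟨fun r a => ?_, fun r a hr ha => ?_⟩
  · rw [SkewMult.isMultiplicitySeq_iff_forall_fin h, SkewMult.forall_isLinked_iff]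
  · rw [SkewMult.isMultiplicitySeq_iff_forall_fin h, ← SkewMult.isLinked_self_iff σ ha]
    exact ⟨fun H => H ⟨0, by omega⟩, fun H _ => H⟩
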